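/- **Proposition 4.4.** Let $\mathbb{K}$ be the field of locally convergent generalized Puiseux series: the formal series $a(t)=\sum_{r\in R}\alpha_r t^r$ with $R\subset\mathbb{R}$ well-ordered and $\alpha_r\in\mathbb{C}$ for which the family $(\alpha_r t^r)_{r\in R}$ is summable (equivalently, $\sum_{r\in R}|\alpha_r|t^r<\infty$) for all sufficiently small $t>0$. For $a\neq 0$ let $\operatorname{coef}(a)$ be the coefficient of the term of lowest exponent and let $\operatorname{val}(a)=-\min\{r:\alpha_r\ne 0\}$. A series is *real* if all its coefficients are real, and *positive* if it is real and $\operatorname{coef}(a)>0$. Let $f_1,f_2\in\mathbb{K}[z_1^{\pm1},z_2^{\pm1}]$ be two Laurent polynomials whose coefficients are all real series, $f_i=\sum_{w\in\mathcal{W}_i}c_{i,w}z^w$ with $\mathcal{W}_i\subset\mathbb{Z}^2$ finite and all $c_{i,w}\neq 0$. Let $T_i\subset\mathbb{R}^2$ be the tropical curve of $f_i$, i.e. the closure of $\{(\operatorname{val}(z_1),\operatorname{val}(z_2)) : z\in(\mathbb{K}^*)^2,\ f_i(z)=0\}$. For $x\in\mathbb{R}^2$ let $\mathcal{I}_i(x)\subset\mathcal{W}_i$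 be the set of exponents at which $\max_{w\in\mathcal{W}_i}\bigl(\langle x,w\rangle+\operatorname{val}(c_{i,w})\bigr)$ is attained. The cells of the subdivision of $\mathbb{R}^2$ induced by $f_i$ are the closures of the non-empty sets on which $\mathcal{I}_i$ is constant; for such a cell $\eta$ let $\mathcal{I}_i(\eta)$ be the common value of $\mathcal{I}_i(x)$ for $x$ in the relative interior of $\eta$, and define the reduced polynomial $$f_{i|\eta}=\sum_{w\in\mathcal{I}_i(\eta)}\operatorname{coef}(c_{i,w})\,z^w .$$ Let $\xi=\xi_1\cap\xi_2$ be a non-empty mixed cell of $T_1\cap T_2$, where $\xi_i$ is a cell of $f_i$ contained in $T_i$ and $\xi$ is not contained in the relative boundary of $\xi_1$ or of $\xi_2$. Assume that $\dim\xi=0$ and that all solutions in $(\mathbb{K}^*)^2$ of the system $f_1=f_2=0$ are non-degenerate (the Jacobian matrix at the solution has full rank). If the reduced system $f_{1|\xi_1}=f_{2|\xi_2}=0$ has a non-degenerate solution $(\rho_1,\rho_2)\in(\mathbb{R}_{>0})^2$, then the system $f_1=f_2=0$ has a non-degenerate solution $(\alpha,\beta)$ with $\alpha,\beta$ positive series such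 that $\xi=\{(\operatorname{val}(\alpha),\operatorname{val}(\beta))\}$ and $(\operatorname{coef}(\alpha),\operatorname{coef}(\beta))=(\rho_1,\rho_2)$. -/

import Mathlib

noncomputable section

namespace PuiseuxTropical

open scoped ENNReal

/-! ### The field of locally convergent generalized Puiseux series -/

/-- A formal series `∑ α_r t^r` with complex coefficients and well-ordered support in `ℝ` is
locally convergent if the family `α_r t^r` is summable for every small enough `t > 0`. -/
def LocallyConvergent (x : HahnSeries ℝ ℂ) : Prop :=
  ∃ ε : ℝ, 0 < ε ∧ ∀ t : ℝ, 0 < t → t < ε →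
    Summable fun r : ℝ => x.coeff r * ((t ^ r : ℝ) : ℂ)

/-- The sum `∑ |α_r| t^r` in `[0, ∞]` (auxiliary, for closure under the field operations). -/
def absSum (x : HahnSeries ℝ ℂ) (t : ℝ) : ℝ≥0∞ :=
  ∑' r : ℝ, ‖x.coeff r‖ₑ * ENNReal.ofReal (t ^ r)

theorem summable_iff_absSum (x : HahnSeries ℝ ℂ) {t : ℝ} (ht : 0 < t) :
    (Summable fun r : ℝ => x.coeff r * ((t ^ r : ℝ) : ℂ)) ↔ absSum x t < ∞ := by
  have h : ∀ r : ℝ, ‖x.coeff r * ((t ^ r : ℝ) : ℂ)‖ₑ = ‖x.coeff r‖ₑ * ENNReal.ofReal (t ^ r) := by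
    intro r
    rw [enorm_mul]
    congr 1
    rw [← ofReal_norm, Complex.norm_real, Real.norm_of_nonneg (by positivity)]
  have h2 : absSum x t = ∑' r : ℝ, ((‖x.coeff r * ((t ^ r : ℝ) : ℂ)‖₊ : NNReal) : ℝ≥0∞) := by
    unfold absSum
    exact tsum_congr fun r => (h r).symm
  rw [h2, lt_top_iff_ne_top, ENNReal.tsum_coe_ne_top_iff_summable, ← summable_norm_iff]
  exact NNReal.summable_coe (f := fun r : ℝ => ‖x.coeff r * ((t ^ r : ℝ) : ℂ)‖₊)

theorem locallyConvergent_iff (x : HahnSeries ℝ ℂ) :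
    LocallyConvergent x ↔ ∃ ε : ℝ, 0 < ε ∧ ∀ t : ℝ, 0 < t → t < ε → absSum x t < ∞ := by
  unfold LocallyConvergent
  refine exists_congr fun ε => and_congr_right fun _ => forall_congr' fun t => ?_
  exact forall_congr' fun ht => by rw [summable_iff_absSum x ht]

theorem absSum_single (a : ℝ) (c : ℂ) (t : ℝ) :
    absSum (HahnSeries.single a c) t = ‖c‖ₑ * ENNReal.ofReal (t ^ a) := by
  unfold absSum
  rw [tsum_eq_single a]
  · simp
  · intro r hr
    simp [HahnSeries.coeff_single_of_ne hr]

theorem absSum_add_le (x y : HahnSeries ℝ ℂ) (t : ℝ) :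
    absSum (x + y) t ≤ absSum x t + absSum y t := by
  unfold absSum
  rw [← ENNReal.tsum_add]
  refine ENNReal.tsum_le_tsum fun r => ?_
  rw [← add_mul, HahnSeries.coeff_add]
  gcongr
  exact enorm_add_le _ _

theorem absSum_neg (x : HahnSeries ℝ ℂ) (t : ℝ) : absSum (-x) t = absSum x t := by
  simp [absSum]

theorem absSum_mul_le (x y : HahnSeries ℝ ℂ) {t : ℝ} (ht : 0 < t) :
    absSum (x * y) t ≤ absSum x t * absSum y t := by
  have key : ∀ r : ℝ, ‖(x * y).coeff r‖ₑ * ENNReal.ofReal (t ^ r) ≤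
      ∑' i : ℝ, (‖x.coeff i‖ₑ * ENNReal.ofReal (t ^ i)) *
        (‖y.coeff (r - i)‖ₑ * ENNReal.ofReal (t ^ (r - i))) := by
    intro r
    rw [HahnSeries.coeff_mul]
    set S := Finset.antidiagonal x.isPWO_support y.isPWO_support r with hS
    have hsum : ∀ ij ∈ S, ij.1 + ij.2 = r := by
      intro ij hij
      rw [hS, Finset.mem_antidiagonal] at hij
      exact hij.2.2
    calc ‖∑ ij ∈ S, x.coeff ij.1 * y.coeff ij.2‖ₑ * ENNReal.ofReal (t ^ r)
        ≤ (∑ ij ∈ S, ‖x.coeff ij.1 * y.coeff ij.2‖ₑ) * ENNReal.ofReal (t ^ r) := by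
          gcongr
          exact enorm_sum_le _ _
      _ = ∑ ij ∈ S, (‖x.coeff ij.1‖ₑ * ENNReal.ofReal (t ^ ij.1)) *
            (‖y.coeff (r - ij.1)‖ₑ * ENNReal.ofReal (t ^ (r - ij.1))) := by
          rw [Finset.sum_mul]
          refine Finset.sum_congr rfl fun ij hij => ?_
          have h2 : r - ij.1 = ij.2 := by rw [← hsum ij hij]; ring
          rw [h2, ← hsum ij hij, Real.rpow_add ht, ENNReal.ofReal_mul (by positivity), enorm_mul]
          ring
      _ = ∑ i ∈ S.image Prod.fst, (‖x.coeff i‖ₑ * ENNReal.ofReal (t ^ i)) *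
            (‖y.coeff (r - i)‖ₑ * ENNReal.ofReal (t ^ (r - i))) := by
          rw [Finset.sum_image]
          intro a ha b hb hab
          have h1 := hsum a ha
          have h2 := hsum b hb
          have hab' : a.1 = b.1 := hab
          refine Prod.ext hab' ?_
          linarith
      _ ≤ _ := ENNReal.sum_le_tsum _
  unfold absSum
  refine (ENNReal.tsum_le_tsum key).trans ?_
  rw [ENNReal.tsum_comm, ← ENNReal.tsum_mul_right]
  refine ENNReal.tsum_le_tsum fun i => ?_
  rw [ENNReal.tsum_mul_left]
  refine mul_le_mul_right ?_ _
  exact ((Equiv.subRight i).tsum_eq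
    (fun r : ℝ => ‖y.coeff r‖ₑ * ENNReal.ofReal (t ^ r))).le

theorem absSum_one (t : ℝ) : absSum 1 t = 1 := by
  rw [← HahnSeries.single_zero_one, absSum_single]
  simp

theorem absSum_pow_le (x : HahnSeries ℝ ℂ) {t : ℝ} (ht : 0 < t) (n : ℕ) :
    absSum (x ^ n) t ≤ absSum x t ^ n := by
  induction n with
  | zero => simp [absSum_one]
  | succ n ih =>
    rw [pow_succ, pow_succ]
    exact (absSum_mul_le _ _ ht).trans (by gcongr)

theorem absSum_hsum_powers_le (x : HahnSeries ℝ ℂ) (hx : 0 < x.orderTop) {t : ℝ} (ht : 0 < t) :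
    absSum (HahnSeries.SummableFamily.powers x).hsum t ≤ ∑' n : ℕ, absSum x t ^ n := by
  have key : ∀ r : ℝ,
      ‖(HahnSeries.SummableFamily.powers x).hsum.coeff r‖ₑ * ENNReal.ofReal (t ^ r) ≤
      ∑' n : ℕ, ‖(x ^ n).coeff r‖ₑ * ENNReal.ofReal (t ^ r) := by
    intro r
    rw [HahnSeries.SummableFamily.coeff_hsum_eq_sum, ENNReal.tsum_mul_right]
    gcongr
    refine (enorm_sum_le _ _).trans ?_
    refine le_trans (le_of_eq ?_) (ENNReal.sum_le_tsum
      ((HahnSeries.SummableFamily.powers x).coeff r).support)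
    refine Finset.sum_congr rfl fun n _ => ?_
    rw [HahnSeries.SummableFamily.powers_of_orderTop_pos hx]
  refine (ENNReal.tsum_le_tsum key).trans ?_
  rw [ENNReal.tsum_comm]
  exact ENNReal.tsum_le_tsum fun n => absSum_pow_le x ht n

/-- For a locally convergent series of positive order, `∑ |α_r| t^r < 1` for small `t > 0`. -/
theorem absSum_lt_one_of_orderTop_pos (x : HahnSeries ℝ ℂ) (hx : 0 < x.orderTop)
    (hc : LocallyConvergent x) :
    ∃ ε : ℝ, 0 < ε ∧ ∀ t : ℝ, 0 < t → t < ε → absSum x t < 1 := by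
  by_cases h0 : x = 0
  · exact ⟨1, one_pos, fun t _ _ => by simp [h0, absSum]⟩
  obtain ⟨ε, hε, h⟩ := (locallyConvergent_iff x).1 hc
  set t₀ := ε / 2 with ht₀
  have ht₀pos : 0 < t₀ := by positivity
  have hfin : absSum x t₀ < ∞ := h t₀ ht₀pos (by linarith)
  have hd : 0 < x.order := by
    have := hx
    rw [← HahnSeries.order_eq_orderTop_of_ne_zero h0] at this
    exact_mod_cast this
  have hle : ∀ s : ℝ, 0 < s → s ≤ 1 →
      absSum x (s * t₀) ≤ ENNReal.ofReal (s ^ x.order) * absSum x t₀ := by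
    intro s hs hs1
    unfold absSum
    rw [← ENNReal.tsum_mul_left]
    refine ENNReal.tsum_le_tsum fun r => ?_
    by_cases hr : x.coeff r = 0
    · simp [hr]
    have hord : x.order ≤ r := HahnSeries.order_le_of_coeff_ne_zero hr
    rw [Real.mul_rpow hs.le ht₀pos.le, ENNReal.ofReal_mul (by positivity)]
    calc ‖x.coeff r‖ₑ * (ENNReal.ofReal (s ^ r) * ENNReal.ofReal (t₀ ^ r))
        = ENNReal.ofReal (s ^ r) * (‖x.coeff r‖ₑ * ENNReal.ofReal (t₀ ^ r)) := by ring
      _ ≤ _ := by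
        refine mul_le_mul_left (ENNReal.ofReal_le_ofReal ?_) _
        exact Real.rpow_le_rpow_of_exponent_ge hs hs1 hord
  set M := (absSum x t₀).toReal with hM
  have hM0 : 0 ≤ M := ENNReal.toReal_nonneg
  have hlim : Filter.Tendsto (fun s : ℝ => s ^ x.order * M) (nhds 0) (nhds 0) := by
    have : ContinuousAt (fun s : ℝ => s ^ x.order * M) 0 :=
      (Real.continuousAt_rpow_const _ _ (Or.inr hd.le)).mul continuousAt_const
    simpa [ContinuousAt, Real.zero_rpow hd.ne'] using this
  obtain ⟨δ, hδ, hδ'⟩ := Metric.eventually_nhds_iff.1 (hlim.eventually (gt_mem_nhds one_pos))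
  refine ⟨min δ 1 * t₀, by positivity, fun t ht htlt => ?_⟩
  have hs : 0 < t / t₀ := by positivity
  have hslt : t / t₀ < min δ 1 := by rwa [div_lt_iff₀ ht₀pos]
  have h1 := hle (t / t₀) hs (hslt.le.trans (min_le_right _ _))
  rw [div_mul_cancel₀ _ ht₀pos.ne'] at h1
  refine h1.trans_lt ?_
  have h2 := hδ' (y := t / t₀) (by
    rw [Real.dist_eq, sub_zero, abs_of_pos hs]
    exact hslt.trans_le (min_le_left _ _))
  rw [← ENNReal.ofReal_toReal hfin.ne, ← hM, ← ENNReal.ofReal_mul (by positivity)]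
  rw [← ENNReal.ofReal_one]
  exact (ENNReal.ofReal_lt_ofReal_iff one_pos).2 h2

theorem LocallyConvergent.add {x y : HahnSeries ℝ ℂ} (hx : LocallyConvergent x)
    (hy : LocallyConvergent y) : LocallyConvergent (x + y) := by
  rw [locallyConvergent_iff] at *
  obtain ⟨a, ha, hx⟩ := hx
  obtain ⟨b, hb, hy⟩ := hy
  refine ⟨min a b, lt_min ha hb, fun t ht htm => (absSum_add_le x y t).trans_lt ?_⟩
  exact ENNReal.add_lt_top.2
    ⟨hx t ht (htm.trans_le (min_le_left _ _)), hy t ht (htm.trans_le (min_le_right _ _))⟩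

theorem LocallyConvergent.mul {x y : HahnSeries ℝ ℂ} (hx : LocallyConvergent x)
    (hy : LocallyConvergent y) : LocallyConvergent (x * y) := by
  rw [locallyConvergent_iff] at *
  obtain ⟨a, ha, hx⟩ := hx
  obtain ⟨b, hb, hy⟩ := hy
  refine ⟨min a b, lt_min ha hb, fun t ht htm => (absSum_mul_le x y ht).trans_lt ?_⟩
  exact ENNReal.mul_lt_top
    (hx t ht (htm.trans_le (min_le_left _ _))) (hy t ht (htm.trans_le (min_le_right _ _)))

theorem LocallyConvergent.neg {x : HahnSeries ℝ ℂ} (hx : LocallyConvergent x) :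
    LocallyConvergent (-x) := by
  simpa only [locallyConvergent_iff, absSum_neg] using hx

theorem locallyConvergent_single (a : ℝ) (c : ℂ) :
    LocallyConvergent (HahnSeries.single a c) := by
  rw [locallyConvergent_iff]
  refine ⟨1, one_pos, fun t _ _ => ?_⟩
  rw [absSum_single]
  exact ENNReal.mul_lt_top (by simp) (by simp)

theorem LocallyConvergent.inv {x : HahnSeries ℝ ℂ} (hx : LocallyConvergent x) :
    LocallyConvergent x⁻¹ := by
  by_cases h0 : x = 0
  · simpa [h0] using locallyConvergent_single 0 0
  rw [HahnSeries.inv_def]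
  refine (locallyConvergent_single _ _).mul ?_
  have hpos := HahnSeries.unit_aux x (inv_mul_cancel₀ (HahnSeries.leadingCoeff_ne_zero.mpr h0)) _
    (neg_add_cancel x.order)
  set y := 1 - HahnSeries.single (-x.order) (x.leadingCoeff)⁻¹ * x with hy
  have hyc : LocallyConvergent y := by
    rw [hy, sub_eq_add_neg, ← HahnSeries.single_zero_one]
    exact (locallyConvergent_single _ _).add ((locallyConvergent_single _ _).mul hx).neg
  obtain ⟨ε, hε, h⟩ := absSum_lt_one_of_orderTop_pos y hpos hyc
  rw [locallyConvergent_iff]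
  refine ⟨ε, hε, fun t ht htε => (absSum_hsum_powers_le y hpos ht).trans_lt ?_⟩
  rw [ENNReal.tsum_geometric, ENNReal.inv_lt_top]
  exact tsub_pos_of_lt (h t ht htε)

/-- The field `𝕂` of locally convergent generalized Puiseux series, as a subfield of the field of
all series with complex coefficients and well-ordered support in `ℝ`. -/
def puiseuxSubfield : Subfield (HahnSeries ℝ ℂ) where
  carrier := {x | LocallyConvergent x}
  mul_mem' := LocallyConvergent.mul
  one_mem' := by
    rw [← HahnSeries.single_zero_one]
    exact locallyConvergent_single 0 1
  add_mem' := LocallyConvergent.add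
  zero_mem' := by simpa using locallyConvergent_single 0 0
  neg_mem' := LocallyConvergent.neg
  inv_mem' := fun _ => LocallyConvergent.inv

/-- The field `𝕂` as a type. -/
abbrev Puiseux : Type := puiseuxSubfield

/-- The coefficient of the term of lowest exponent (it is `0` only for the zero series). -/
def coef (a : Puiseux) : ℂ := (a : HahnSeries ℝ ℂ).leadingCoeff

/-- The valuation of a nonzero series: minus the lowest exponent. It is only used for nonzero
arguments. -/
def val (a : Puiseux) : ℝ := -(a : HahnSeries ℝ ℂ).order

/-- A series is real if all its coefficients are real. -/
def IsReal (a : Puiseux) : Prop := ∀ r : ℝ, ((a : HahnSeries ℝ ℂ).coeff r).im = 0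

/-- A series is positive if it is real and its leading coefficient is positive. -/
def IsPositive (a : Puiseux) : Prop := IsReal a ∧ 0 < (coef a).re

/-! ### Laurent polynomials in two variables -/

/-- Laurent polynomials `∑ c_w z^w` in `z = (z₁, z₂)`, with exponents `w ∈ ℤ²`. -/
abbrev Laurent (F : Type) [Field F] : Type := AddMonoidAlgebra F (Fin 2 → ℤ)

/-- The value of a Laurent polynomial at a point (with nonzero coordinates). -/
def evalAt {F : Type} [Field F] (f : Laurent F) (z : Fin 2 → F) : F :=
  ∑ w ∈ f.coeff.support, f.coeff w * ∏ j, z j ^ w j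

/-- The formal partial derivative with respect to `z_j`. -/
def partialDeriv {F : Type} [Field F] (j : Fin 2) (f : Laurent F) : Laurent F :=
  ∑ w ∈ f.coeff.support, AddMonoidAlgebra.single (w - Pi.single j 1) ((w j : F) * f.coeff w)

/-- `z` is a solution in the torus `(F*)²` of the system `f₀ = f₁ = 0`. -/
def IsSolution {F : Type} [Field F] (f : Fin 2 → Laurent F) (z : Fin 2 → F) : Prop :=
  (∀ j, z j ≠ 0) ∧ ∀ i, evalAt (f i) z = 0

/-- The Jacobian matrix of the system at `z`. -/
def jacobian {F : Type} [Field F] (f : Fin 2 → Laurent F) (z : Fin 2 → F) :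
    Matrix (Fin 2) (Fin 2) F :=
  Matrix.of fun i j => evalAt (partialDeriv j (f i)) z

/-- `z` is a non-degenerate solution in the torus: the Jacobian matrix has full rank at `z`. -/
def IsNondegenerateSolution {F : Type} [Field F] (f : Fin 2 → Laurent F) (z : Fin 2 → F) : Prop :=
  IsSolution f z ∧ (jacobian f z).det ≠ 0

/-! ### Tropical curves, cells and reduced systems -/

/-- The tropical curve of `f`: the closure of the image under the coordinatewise valuation of the
zero set of `f` in `(𝕂*)²`. -/
def tropicalCurve (f : Laurent Puiseux) : Set (Fin 2 → ℝ) :=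
  closure {x | ∃ z : Fin 2 → Puiseux, (∀ j, z j ≠ 0) ∧ evalAt f z = 0 ∧ x = fun j => val (z j)}

/-- The affine function `x ↦ ⟨x, w⟩ + val (c_w)` belonging to the exponent `w`. -/
def tropTerm (f : Laurent Puiseux) (w : Fin 2 → ℤ) (x : Fin 2 → ℝ) : ℝ :=
  ∑ j, x j * (w j : ℝ) + val (f.coeff w)

/-- The set of `w` in the support of `f` at which the maximum
`f_trop(x) = max_w (⟨x, w⟩ + val (c_w))` is attained. -/
def maxSupport (f : Laurent Puiseux) (x : Fin 2 → ℝ) : Set (Fin 2 → ℤ) :=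
  {w | w ∈ f.coeff.support ∧ ∀ v ∈ f.coeff.support, tropTerm f v x ≤ tropTerm f w x}

/-- The cells of the polyhedral subdivision of `ℝ²` induced by `f`. The cell with `x` in its
relative interior consists of the `y` such that all the terms that are maximal at `x` are still
maximal at `y`; it is the closure of the set of `y` with the same maximal terms as `x`. -/
def IsCell (f : Laurent Puiseux) (ξ : Set (Fin 2 → ℝ)) : Prop :=
  ∃ x : Fin 2 → ℝ, ξ = {y | maxSupport f x ⊆ maxSupport f y}

/-- The exponents whose terms are maximal on the whole cell `ξ`; these are the exponents whose
terms are maximal at any one relative interior point of `ξ`, and their convex hull is the polytope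
dual to `ξ`. -/
def cellSupport (f : Laurent Puiseux) (ξ : Set (Fin 2 → ℝ)) : Set (Fin 2 → ℤ) :=
  {w | w ∈ f.coeff.support ∧ ∀ x ∈ ξ, w ∈ maxSupport f x}

open Classical in
/-- The reduced polynomial `f_{|ξ} = ∑ coef(c_w) z^w` over the exponents `w` belonging to `ξ`. -/
def reduced (f : Laurent Puiseux) (ξ : Set (Fin 2 → ℝ)) : Laurent ℂ :=
  ∑ w ∈ f.coeff.support with w ∈ cellSupport f ξ, AddMonoidAlgebra.single w (coef (f.coeff w))

/-- The cells `ξ₀` of `T₀` and `ξ₁` of `T₁` represent a mixed cell `ξ = ξ₀ ∩ ξ₁` of `T₀ ∩ T₁`: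
it is non-empty and not contained in the (relative) boundary of `ξ₀` or of `ξ₁`. -/
structure IsMixedCell (f : Fin 2 → Laurent Puiseux) (ξ : Fin 2 → Set (Fin 2 → ℝ)) : Prop where
  isCell : ∀ i, IsCell (f i) (ξ i)
  subset_curve : ∀ i, ξ i ⊆ tropicalCurve (f i)
  nonempty : (⋂ i, ξ i).Nonempty
  not_subset_boundary : ∀ i, ¬ (⋂ k, ξ k) ⊆ intrinsicFrontier ℝ (ξ i)

/-- The dimension of a polyhedron: the dimension of its affine hull. -/
def dim (s : Set (Fin 2 → ℝ)) : ℕ := Module.finrank ℝ (vectorSpan ℝ s)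

end PuiseuxTropical

end

noncomputable section

namespace PuiseuxTropical

open scoped ENNReal
open MvPolynomial (eval C X)

/-! ### Real series -/

/-! Let `x` be the only point of the mixed cell and `M i` the maximum of the tropical terms of `f i`
at `x`. Substitute `z j = t ^ (-x j) * y j` and multiply `f i` by `t ^ (M i)`. The coefficient at
`w` then has lowest exponent `M i - tropTerm (f i) w x ≥ 0`, with equality exactly for the maximal
terms. So the new system has coefficients in the ring `realIntegers`, and its residue at `t = 0` is
the reduced system: since `x` avoids both relative boundaries, the exponents of each cell are those
maximal at `x` (`cellSupport_eq_maxSupport`). Multiplying by a monomial makes the polynomials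
ordinary. Now `ρ` is a simple real zero of the residue system, and Hensel's lemma
(`exists_hensel_lift`) lifts it to a zero `y` with residue `ρ`. The series `t ^ (-x j) * y j` have
the required valuation and leading coefficient.

For Hensel's lemma, write `y = ρ + s * h` with `s = t ^ ε`, where `ε` is so small that `s ^ 2`
divides the values at `ρ` and `s` divides the error in the Jacobian. Taylor expansion turns the
system into `h = s * Q(h)`, a contraction for the valuation (`exists_fixedPoint`). The iterates
stabilize coefficientwise. The limit is locally convergent because, for all small `t`, the map
preserves the condition `∑ |α_r| t^r ≤ 1`, so the bound is uniform over the iterates. -/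

theorem IsReal.add {a b : Puiseux} (ha : IsReal a) (hb : IsReal b) : IsReal (a + b) := by
  intro r
  simp [ha r, hb r]

theorem IsReal.neg {a : Puiseux} (ha : IsReal a) : IsReal (-a) := by
  intro r
  simp [ha r]

theorem IsReal.mul {a b : Puiseux} (ha : IsReal a) (hb : IsReal b) : IsReal (a * b) := by
  intro r
  rw [Subfield.coe_mul, HahnSeries.coeff_mul, Complex.im_sum]
  exact Finset.sum_eq_zero fun ij _ => by simp [Complex.mul_im, ha ij.1, hb ij.2]

/-- The monomial `c t^a`. -/
def term (a : ℝ) (c : ℂ) : Puiseux := ⟨HahnSeries.single a c, locallyConvergent_single a c⟩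

theorem coe_term (a : ℝ) (c : ℂ) : (term a c : HahnSeries ℝ ℂ) = HahnSeries.single a c := rfl

theorem isReal_term (a c : ℝ) : IsReal (term a c) := by
  intro r
  rw [coe_term, HahnSeries.coeff_single]
  split_ifs <;> simp

theorem term_mul_term (a b : ℝ) (c d : ℂ) : term a c * term b d = term (a + b) (c * d) :=
  Subtype.ext HahnSeries.single_mul_single

theorem term_zero_one : term 0 1 = 1 := rfl

theorem coeff_term_mul (a r : ℝ) (c : ℂ) (x : Puiseux) :
    ((term a c * x : Puiseux) : HahnSeries ℝ ℂ).coeff r = c * (x : HahnSeries ℝ ℂ).coeff (r - a) :=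
  HahnSeries.coeff_single_mul

theorem term_one_ne_zero (a : ℝ) : term a 1 ≠ 0 := by
  intro h
  have := congrArg (fun x : Puiseux => (x : HahnSeries ℝ ℂ).coeff a) h
  simp [coe_term] at this

theorem term_zpow (a : ℝ) (n : ℤ) : term a 1 ^ n = term (n * a) 1 := by
  have hnat : ∀ n : ℕ, term a 1 ^ n = term (n * a) 1 := by
    intro n
    induction n with
    | zero => simp [term_zero_one]
    | succ n ih =>
      rw [pow_succ, ih, term_mul_term]
      congr 1
      · push_cast; ring
      · simp
  cases n with
  | ofNat n => simpa using hnat n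
  | negSucc n =>
    rw [zpow_negSucc, hnat, inv_eq_of_mul_eq_one_left]
    rw [term_mul_term, mul_one, ← term_zero_one]
    congr 1
    push_cast; ring

/-! ### The ring of real series without negative exponents -/

/-- Real locally convergent series without negative exponents. -/
def realIntegers : Subring Puiseux where
  carrier := {x | IsReal x ∧ ∀ r < 0, (x : HahnSeries ℝ ℂ).coeff r = 0}
  mul_mem' := by
    rintro a b ⟨ha, ha'⟩ ⟨hb, hb'⟩
    refine ⟨ha.mul hb, fun r hr => ?_⟩
    rw [Subfield.coe_mul, HahnSeries.coeff_mul]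
    refine Finset.sum_eq_zero fun ij hij => ?_
    have h : ij.1 + ij.2 = r := (Finset.mem_antidiagonal.1 hij).2.2
    rcases lt_or_ge ij.1 0 with h1 | h1
    · rw [ha' _ h1, zero_mul]
    · rw [hb' _ (by linarith), mul_zero]
  one_mem' := ⟨by simpa [term_zero_one] using isReal_term 0 1, fun r hr => by
    simp [HahnSeries.coeff_one, hr.ne]⟩
  add_mem' := by
    rintro a b ⟨ha, ha'⟩ ⟨hb, hb'⟩
    exact ⟨ha.add hb, fun r hr => by simp [ha' r hr, hb' r hr]⟩
  zero_mem' := ⟨fun r => by simp, fun r _ => by simp⟩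
  neg_mem' := by
    rintro a ⟨ha, ha'⟩
    exact ⟨ha.neg, fun r hr => by simp [ha' r hr]⟩

/-- The underlying Hahn series. -/
abbrev toHahn (x : realIntegers) : HahnSeries ℝ ℂ := ((x : Puiseux) : HahnSeries ℝ ℂ)

theorem toHahn_injective : Function.Injective toHahn :=
  Subtype.val_injective.comp Subtype.val_injective

theorem toHahn_add (x y : realIntegers) : toHahn (x + y) = toHahn x + toHahn y := rfl
theorem toHahn_sub (x y : realIntegers) : toHahn (x - y) = toHahn x - toHahn y := rfl
theorem toHahn_mul (x y : realIntegers) : toHahn (x * y) = toHahn x * toHahn y := rfl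

theorem coeff_eq_zero_of_neg (x : realIntegers) {r : ℝ} (hr : r < 0) : (toHahn x).coeff r = 0 :=
  x.2.2 r hr

theorem coeff_zero_mul (x y : realIntegers) :
    (toHahn (x * y)).coeff 0 = (toHahn x).coeff 0 * (toHahn y).coeff 0 := by
  rw [toHahn_mul, HahnSeries.coeff_mul]
  rw [Finset.sum_eq_single (0, 0)]
  · intro ij hij hne
    have h : ij.1 + ij.2 = 0 := (Finset.mem_antidiagonal.1 hij).2.2
    rcases lt_trichotomy ij.1 0 with h1 | h1 | h1
    · rw [coeff_eq_zero_of_neg x h1, zero_mul]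
    · exact absurd (Prod.ext h1 (by simpa [h1] using h)) hne
    · rw [coeff_eq_zero_of_neg y (by linarith), mul_zero]
  · intro h
    simp only [Finset.mem_antidiagonal, HahnSeries.mem_support, add_zero, and_true,
      not_and_or, not_not] at h
    rcases h with h | h <;> simp [h]

/-- Reduction: the constant coefficient. -/
def residue : realIntegers →+* ℝ where
  toFun x := ((toHahn x).coeff 0).re
  map_one' := by simp [toHahn]
  map_zero' := by simp [toHahn]
  map_add' x y := by simp [toHahn]
  map_mul' x y := by
    rw [coeff_zero_mul, Complex.mul_re, x.2.1 0, y.2.1 0]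
    simp

theorem coeff_zero_eq_residue (x : realIntegers) : (toHahn x).coeff 0 = (residue x : ℂ) :=
  Complex.ext rfl (by simpa using x.2.1 0)

/-- The inclusion of the constants. -/
def const : ℝ →+* realIntegers where
  toFun c := ⟨term 0 c, isReal_term 0 c, fun r hr => by
    rw [coe_term, HahnSeries.coeff_single_of_ne hr.ne]⟩
  map_one' := rfl
  map_zero' := Subtype.ext (Subtype.ext (by simp [coe_term]))
  map_add' x y := Subtype.ext (Subtype.ext (by simp [coe_term]))
  map_mul' x y := Subtype.ext (by simp [term_mul_term])

theorem residue_const (c : ℝ) : residue (const c) = c := by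
  change ((HahnSeries.single (0 : ℝ) (c : ℂ)).coeff 0).re = c
  simp

/-- The power `t^a` with `a ≥ 0` (and `1` for `a < 0`). -/
def tPow (a : ℝ) : realIntegers :=
  ⟨term (max a 0) 1, by simpa using isReal_term (max a 0) 1, fun r hr => by
    rw [coe_term, HahnSeries.coeff_single_of_ne (hr.trans_le (le_max_right _ _)).ne]⟩

theorem coe_tPow {a : ℝ} (ha : 0 ≤ a) : (tPow a : Puiseux) = term a 1 := by
  simp [tPow, max_eq_left ha]

theorem tPow_add {a b : ℝ} (ha : 0 ≤ a) (hb : 0 ≤ b) : tPow (a + b) = tPow a * tPow b :=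
  Subtype.ext (by
    rw [Subring.coe_mul, coe_tPow ha, coe_tPow hb, coe_tPow (add_nonneg ha hb), term_mul_term,
      mul_one])

theorem tPow_zero : tPow 0 = 1 := Subtype.ext (by simp [coe_tPow le_rfl, term_zero_one])

theorem tPow_pow {a : ℝ} (ha : 0 ≤ a) (n : ℕ) : tPow a ^ n = tPow (n * a) := by
  induction n with
  | zero => simp [tPow_zero]
  | succ n ih =>
    rw [pow_succ, ih, ← tPow_add (by positivity) ha]
    congr 1
    push_cast; ring

/-- Translates valuation estimates into divisibility, so that congruences modulo powers of `t`
follow from ring algebra. -/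
theorem tPow_dvd_iff {a : ℝ} (ha : 0 ≤ a) {x : realIntegers} :
    tPow a ∣ x ↔ ∀ r < a, (toHahn x).coeff r = 0 := by
  constructor
  · rintro ⟨y, rfl⟩ r hr
    rw [toHahn, Subring.coe_mul, coe_tPow ha, coeff_term_mul, coeff_eq_zero_of_neg y (by linarith),
      mul_zero]
  · intro h
    refine ⟨⟨term (-a) 1 * x, ?_, fun r hr => ?_⟩, Subtype.ext ?_⟩
    · exact IsReal.mul (by simpa using isReal_term (-a) 1) x.2.1
    · rw [coeff_term_mul, h _ (by linarith), mul_zero]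
    · rw [Subring.coe_mul, coe_tPow ha, ← mul_assoc, term_mul_term]
      simp [term_zero_one]

theorem exists_tPow_dvd_of_residue_eq_zero {x : realIntegers} (hx : residue x = 0) :
    ∃ ε > 0, tPow ε ∣ x := by
  by_cases h0 : toHahn x = 0
  · exact ⟨1, one_pos, (tPow_dvd_iff zero_le_one).2 fun r _ => by simp [h0]⟩
  have hne := HahnSeries.coeff_order_eq_zero.not.2 h0
  have hpos : 0 < (toHahn x).order := by
    rcases lt_trichotomy (toHahn x).order 0 with h | h | h
    · exact absurd (coeff_eq_zero_of_neg x h) hne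
    · rw [h, coeff_zero_eq_residue, hx] at hne
      exact absurd Complex.ofReal_zero hne
    · exact h
  exact ⟨_, hpos, (tPow_dvd_iff hpos.le).2 fun r hr => HahnSeries.coeff_eq_zero_of_lt_order hr⟩

theorem tPow_dvd_tPow {a b : ℝ} (ha : 0 ≤ a) (hab : a ≤ b) : tPow a ∣ tPow b :=
  ⟨tPow (b - a), by rw [← tPow_add ha (by linarith)]; congr 1; ring⟩

/-- Exponents are real, so positive orders have no universal lower bound; a common `ε` exists
because the family is finite. -/
theorem exists_tPow_dvd_of_finite {ι : Type*} [Finite ι] (x : ι → realIntegers)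
    (hx : ∀ i, residue (x i) = 0) : ∃ ε > 0, ∀ i, tPow ε ∣ x i := by
  classical
  cases nonempty_fintype ι
  choose e he hdvd using fun i => exists_tPow_dvd_of_residue_eq_zero (hx i)
  obtain ⟨ε, hε, hle⟩ : ∃ ε > 0, ∀ i, ε ≤ e i := by
    cases isEmpty_or_nonempty ι
    · exact ⟨1, one_pos, isEmptyElim⟩
    · obtain ⟨i, hi⟩ := Finite.exists_min e
      exact ⟨e i, he i, hi⟩
  exact ⟨ε, hε, fun i => (tPow_dvd_tPow hε.le (hle i)).trans (hdvd i)⟩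

theorem residue_tPow {a : ℝ} (ha : 0 < a) : residue (tPow a) = 0 := by
  simp [residue, toHahn, coe_tPow ha.le, coe_term, HahnSeries.coeff_single_of_ne ha.ne]

/-! ### Evaluation of polynomials -/

theorem _root_.MvPolynomial.dvd_eval_sub_eval {σ R : Type*} [CommRing R] {d : R} {a b : σ → R}
    (h : ∀ j, d ∣ a j - b j) (p : MvPolynomial σ R) : d ∣ eval a p - eval b p := by
  induction p using MvPolynomial.induction_on with
  | C c => simp
  | add p q hp hq =>
    rw [map_add, map_add, add_sub_add_comm]
    exact dvd_add hp hq
  | mul_X p j hp =>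
    have : eval a (p * X j) - eval b (p * X j) =
        (eval a p - eval b p) * a j + eval b p * (a j - b j) := by simp; ring
    rw [this]
    exact dvd_add (hp.mul_right _) ((h j).mul_left _)

/-- Second-order Taylor expansion. -/
theorem _root_.MvPolynomial.exists_taylor {σ R : Type*} [Fintype σ] [CommRing R]
    (a : σ → R) (s : R) (p : MvPolynomial σ R) :
    ∃ q : MvPolynomial σ R, ∀ h : σ → R, eval (fun j => a j + s * h j) p =
      eval a p + s * ∑ j, eval a (MvPolynomial.pderiv j p) * h j + s ^ 2 * eval h q := by
  classical
  induction p using MvPolynomial.induction_on with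
  | C c => exact ⟨0, fun h => by simp⟩
  | add p q hp hq =>
    obtain ⟨p', hp⟩ := hp
    obtain ⟨q', hq⟩ := hq
    refine ⟨p' + q', fun h => ?_⟩
    simp only [map_add, hp, hq, add_mul, Finset.sum_add_distrib]
    ring
  | mul_X p i hp =>
    obtain ⟨p', hp⟩ := hp
    refine ⟨p' * C (a i) + C s * p' * X i +
      (∑ j, C (eval a (MvPolynomial.pderiv j p)) * X j) * X i, fun h => ?_⟩
    have hder : ∑ j, eval a (MvPolynomial.pderiv j (p * X i)) * h j =
        (∑ j, eval a (MvPolynomial.pderiv j p) * h j) * a i + eval a p * h i := by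
      simp only [MvPolynomial.pderiv_mul, MvPolynomial.pderiv_X, map_add, map_mul,
        MvPolynomial.eval_X, add_mul, Finset.sum_add_distrib]
      congr 1
      · rw [Finset.sum_mul]
        exact Finset.sum_congr rfl fun j _ => by ring
      · rw [Finset.sum_eq_single i (fun j _ hj => by simp [hj.symm]) (by simp)]
        simp
    rw [hder, map_mul, hp, MvPolynomial.eval_X]
    simp only [map_add, map_mul, map_sum, MvPolynomial.eval_C, MvPolynomial.eval_X]
    ring

/-! ### Fixed points -/

/-- Only exponents `r ≥ 0` contribute, and for these `t ^ r` increases with `t`. -/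
theorem absSum_mono (x : realIntegers) {s t : ℝ} (hs : 0 < s) (hst : s ≤ t) :
    absSum (toHahn x) s ≤ absSum (toHahn x) t := by
  refine ENNReal.tsum_le_tsum fun r => ?_
  rcases lt_or_ge r 0 with hr | hr
  · simp [coeff_eq_zero_of_neg x hr]
  · gcongr

/-- `absSum` is subadditive and submultiplicative, so only the coefficients of `p` matter. The bound
`K` is independent of both `t` and `h`. -/
theorem exists_absSum_eval_le {σ : Type*} (p : MvPolynomial σ realIntegers) :
    ∃ t₀ > 0, ∃ K : NNReal, ∀ t, 0 < t → t < t₀ → ∀ h : σ → realIntegers,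
      (∀ j, absSum (toHahn (h j)) t ≤ 1) → absSum (toHahn (eval h p)) t ≤ K := by
  induction p using MvPolynomial.induction_on with
  | C c =>
    obtain ⟨ε, hε, hc⟩ := (locallyConvergent_iff _).1 (c : Puiseux).2
    -- Halving `ε` gives an endpoint where the sum is finite; by monotonicity its value there bounds
    -- all smaller `t`.
    refine ⟨ε / 2, half_pos hε, (absSum (toHahn c) (ε / 2)).toNNReal, fun t ht htε h _ => ?_⟩
    rw [ENNReal.coe_toNNReal (hc _ (half_pos hε) (half_lt_self hε)).ne, MvPolynomial.eval_C]
    exact absSum_mono c ht htε.le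
  | add p q hp hq =>
    obtain ⟨t₁, ht₁, K, hp⟩ := hp
    obtain ⟨t₂, ht₂, M, hq⟩ := hq
    refine ⟨min t₁ t₂, lt_min ht₁ ht₂, K + M, fun t ht htm h hh => ?_⟩
    rw [map_add, ENNReal.coe_add, toHahn_add]
    exact (absSum_add_le _ _ _).trans (add_le_add
      (hp t ht (htm.trans_le (min_le_left _ _)) h hh)
      (hq t ht (htm.trans_le (min_le_right _ _)) h hh))
  | mul_X p j hp =>
    obtain ⟨t₁, ht₁, K, hp⟩ := hp
    refine ⟨t₁, ht₁, K, fun t ht htm h hh => ?_⟩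
    rw [map_mul, MvPolynomial.eval_X, toHahn_mul, ← mul_one (K : ℝ≥0∞)]
    exact (absSum_mul_le _ _ ht).trans (mul_le_mul' (hp t ht htm h hh) (hh j))

theorem exists_absSum_tPow_mul_eval_le {σ : Type*} {ε : ℝ} (hε : 0 < ε)
    (p : MvPolynomial σ realIntegers) :
    ∃ t₀ > 0, ∀ t, 0 < t → t < t₀ → ∀ h : σ → realIntegers,
      (∀ j, absSum (toHahn (h j)) t ≤ 1) → absSum (toHahn (tPow ε * eval h p)) t ≤ 1 := by
  obtain ⟨t₀, ht₀, K, hK⟩ := exists_absSum_eval_le p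
  -- Below this threshold `t ^ ε ≤ 1 / (K + 1)`, so the factor `t ^ ε` absorbs the bound `K`.
  refine ⟨min t₀ (((K : ℝ) + 1)⁻¹ ^ ε⁻¹), lt_min ht₀ (by positivity), fun t ht htm h hh => ?_⟩
  rw [toHahn_mul]
  refine (absSum_mul_le _ _ ht).trans ?_
  have h1 : absSum (toHahn (tPow ε)) t ≤ ENNReal.ofReal ((K : ℝ) + 1)⁻¹ := by
    rw [toHahn, coe_tPow hε.le, coe_term, absSum_single]
    simp only [enorm_one, one_mul]
    refine ENNReal.ofReal_le_ofReal ?_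
    calc t ^ ε ≤ (((K : ℝ) + 1)⁻¹ ^ ε⁻¹) ^ ε := by
          gcongr
          exact (htm.trans_le (min_le_right _ _)).le
      _ = _ := Real.rpow_inv_rpow (by positivity) hε.ne'
  calc _ ≤ ENNReal.ofReal ((K : ℝ) + 1)⁻¹ * K :=
        mul_le_mul' h1 (hK t ht (htm.trans_le (min_le_left _ _)) h hh)
    _ = ENNReal.ofReal (((K : ℝ) + 1)⁻¹ * K) := by
        rw [ENNReal.ofReal_mul (by positivity), ENNReal.ofReal_coe_nnreal]
    _ ≤ 1 := by
        rw [ENNReal.ofReal_le_one, inv_mul_le_iff₀ (by positivity)]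
        linarith

/-- A sequence either stays below its first term, where the hypothesis applies, or has a later term
exceeding the first. -/
theorem isPWO_of_forall_inter_Iic {s : Set ℝ} (h : ∀ a, (s ∩ Set.Iic a).IsPWO) : s.IsPWO := by
  refine Set.partiallyWellOrderedOn_iff_exists_lt.2 fun f hf => ?_
  by_cases hle : ∀ n, f n ≤ f 0
  · exact Set.partiallyWellOrderedOn_iff_exists_lt.1 (h (f 0)) f fun n => ⟨hf n, hle n⟩
  · push Not at hle
    obtain ⟨n, hn⟩ := hle
    exact ⟨0, n, Nat.pos_of_ne_zero fun h0 => by simp [h0] at hn, hn.le⟩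

/-- A Cauchy sequence for the valuation, uniformly bounded near `t = 0`, converges. -/
theorem exists_limit {ε t₀ : ℝ} (hε : 0 < ε) (ht₀ : 0 < t₀) (x : ℕ → realIntegers)
    (hx : ∀ n : ℕ, tPow (n * ε) ∣ x (n + 1) - x n)
    (hbd : ∀ n t, 0 < t → t < t₀ → absSum (toHahn (x n)) t ≤ 1) :
    ∃ y : realIntegers, ∀ n : ℕ, tPow (n * ε) ∣ y - x n := by
  have hstab : ∀ n m : ℕ, n ≤ m → ∀ r < n * ε,
      (toHahn (x m)).coeff r = (toHahn (x n)).coeff r := by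
    intro n m hnm r hr
    induction m, hnm using Nat.le_induction with
    | base => rfl
    | succ m hnm ih =>
      have h1 := (tPow_dvd_iff (by positivity)).1 (hx m) r
        (hr.trans_le (by gcongr))
      rw [toHahn_sub, HahnSeries.coeff_sub, sub_eq_zero] at h1
      rw [h1, ih]
  obtain ⟨N, hN⟩ : ∃ N : ℝ → ℕ, ∀ r, r < N r * ε := by
    choose N hN using fun r : ℝ => exists_nat_gt (r / ε)
    exact ⟨N, fun r => (div_lt_iff₀ hε).1 (hN r)⟩
  -- The coefficient at `r` no longer changes from the iterate `N r` on; `c` collects these stable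
  -- values.
  set c : ℝ → ℂ := fun r => (toHahn (x (N r))).coeff r with hc
  have hcoeff : ∀ (n : ℕ) (r : ℝ), r < n * ε → (toHahn (x n)).coeff r = c r := by
    intro n r hr
    rcases le_total n (N r) with h | h
    · exact (hstab _ _ h r hr).symm
    · exact hstab _ _ h r (hN r)
  have hpwo : (Function.support c).IsPWO := by
    refine isPWO_of_forall_inter_Iic fun a => (toHahn (x (N a))).isPWO_support.mono ?_
    rintro r ⟨hr, hra⟩
    rw [HahnSeries.mem_support, hcoeff _ _ (lt_of_le_of_lt hra (hN a))]
    exact hr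
  have hconv : LocallyConvergent ⟨c, hpwo⟩ := by
    rw [locallyConvergent_iff]
    refine ⟨t₀, ht₀, fun t ht htt => lt_of_le_of_lt ?_ ENNReal.one_lt_top⟩
    unfold absSum
    rw [ENNReal.tsum_eq_iSup_sum]
    refine iSup_le fun S => ?_
    -- A finite partial sum of the limit agrees with one of a single iterate, and so inherits the
    -- uniform bound.
    obtain ⟨n, hn⟩ : ∃ n : ℕ, ∀ r ∈ S, r < n * ε := by
      obtain ⟨b, hb⟩ := S.bddAbove
      exact ⟨N b, fun r hr => (hb hr).trans_lt (hN b)⟩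
    refine le_trans ?_ (hbd n t ht htt)
    refine le_trans (le_of_eq ?_) (ENNReal.sum_le_tsum S)
    exact Finset.sum_congr rfl fun r hr => by rw [hcoeff n r (hn r hr)]
  refine ⟨⟨⟨⟨c, hpwo⟩, hconv⟩, fun r => (x (N r)).2.1 r, fun r hr =>
    coeff_eq_zero_of_neg (x (N r)) hr⟩, fun n => ?_⟩
  rw [tPow_dvd_iff (by positivity)]
  intro r hr
  rw [toHahn_sub, HahnSeries.coeff_sub, hcoeff n r hr, sub_self]

theorem eq_zero_of_forall_tPow_dvd {ε : ℝ} (hε : 0 < ε) {x : realIntegers}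
    (hx : ∀ n : ℕ, tPow (n * ε) ∣ x) : x = 0 := by
  refine toHahn_injective (HahnSeries.ext (funext fun r => ?_))
  obtain ⟨n, hn⟩ := exists_nat_gt (r / ε)
  exact (tPow_dvd_iff (by positivity)).1 (hx n) r ((div_lt_iff₀ hε).1 hn)

/-- Contractive polynomial systems have fixed points. -/
theorem exists_fixedPoint {σ : Type*} [Finite σ] {ε : ℝ} (hε : 0 < ε)
    (Q : σ → MvPolynomial σ realIntegers) :
    ∃ h : σ → realIntegers, ∀ j, h j = tPow ε * eval h (Q j) := by
  cases nonempty_fintype σ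
  set F : (σ → realIntegers) → σ → realIntegers := fun h j => tPow ε * eval h (Q j) with hF
  have hlip : ∀ (n : ℕ) (a b : σ → realIntegers), (∀ j, tPow (n * ε) ∣ a j - b j) →
      ∀ j, tPow ((n + 1 : ℕ) * ε) ∣ F a j - F b j := by
    intro n a b hab j
    rw [← tPow_pow hε.le, pow_succ', tPow_pow hε.le, hF, ← mul_sub]
    exact mul_dvd_mul_left _ (MvPolynomial.dvd_eval_sub_eval hab _)
  set x : ℕ → σ → realIntegers := fun n => F^[n] 0 with hxdef
  have hxs : ∀ n, x (n + 1) = F (x n) := fun n => Function.iterate_succ_apply' F n 0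
  have hstep : ∀ (n : ℕ) j, tPow (n * ε) ∣ x (n + 1) j - x n j := by
    intro n
    induction n with
    | zero => intro j; simp [tPow_zero]
    | succ n ih =>
      intro j
      rw [hxs (n + 1)]
      nth_rewrite 2 [hxs n]
      exact hlip n _ _ ih j
  obtain ⟨t₀, ht₀, hbd⟩ : ∃ t₀ > 0, ∀ n t, 0 < t → t < t₀ → ∀ j,
      absSum (toHahn (x n j)) t ≤ 1 := by
    choose T hT hb using fun j => exists_absSum_tPow_mul_eval_le hε (Q j)
    obtain ⟨t₀, ht₀, hle⟩ : ∃ t₀ > 0, ∀ i, t₀ ≤ T i := by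
      cases isEmpty_or_nonempty σ
      · exact ⟨1, one_pos, isEmptyElim⟩
      · obtain ⟨i, hi⟩ := Finite.exists_min T
        exact ⟨T i, hT i, hi⟩
    refine ⟨t₀, ht₀, fun n t ht htt => ?_⟩
    induction n with
    | zero => intro j; simp [hxdef, absSum, toHahn]
    | succ n ih =>
      intro j
      rw [hxs]
      exact hb j t ht (htt.trans_le (hle j)) _ ih
  choose y hy using fun j => exists_limit hε ht₀ (fun n => x n j) (fun n => hstep n j)
    (fun n t ht htt => hbd n t ht htt j)
  refine ⟨y, fun j => sub_eq_zero.1 (eq_zero_of_forall_tPow_dvd hε fun n => ?_)⟩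
  -- Both `y` and `F y` are close to `x (n + 1) = F (x n)`, hence to each other.
  have h1 := hlip n y (x n) (fun j => hy j n) j
  rw [← hxs] at h1
  have h2 := dvd_sub (hy j (n + 1)) h1
  refine (tPow_dvd_tPow (by positivity) (by gcongr; simp)).trans (h2.trans (dvd_of_eq ?_))
  simp only [hF]
  ring

/-- Multivariate Hensel lemma for the ring of real locally convergent series. -/
theorem exists_hensel_lift {σ : Type*} [Fintype σ] [DecidableEq σ]
    (G : σ → MvPolynomial σ realIntegers) (ρ : σ → ℝ)
    (hzero : ∀ i, eval ρ (MvPolynomial.map residue (G i)) = 0)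
    (hdet : (Matrix.of fun i j =>
      eval ρ (MvPolynomial.pderiv j (MvPolynomial.map residue (G i)))).det ≠ 0) :
    ∃ y : σ → realIntegers, (∀ i, eval y (G i) = 0) ∧ ∀ j, residue (y j) = ρ j := by
  set a : σ → realIntegers := fun j => const (ρ j) with ha
  have hres : ∀ p : MvPolynomial σ realIntegers,
      residue (eval a p) = eval ρ (MvPolynomial.map residue p) := by
    intro p
    rw [MvPolynomial.map_eval]
    congr 2
    exact funext fun j => residue_const _
  set D : Matrix σ σ ℝ := Matrix.of fun i j =>
    eval ρ (MvPolynomial.pderiv j (MvPolynomial.map residue (G i))) with hD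
  obtain ⟨ε', hε', hdvd⟩ := exists_tPow_dvd_of_finite
    (Sum.elim (fun i => eval a (G i))
      (fun ij : σ × σ => eval a (MvPolynomial.pderiv ij.2 (G ij.1)) - const (D ij.1 ij.2)))
    (by
      rintro (i | ⟨i, j⟩)
      · simp [hres, hzero]
      · simp [hres, residue_const, hD, MvPolynomial.pderiv_map])
  -- One half of the available order is spent on the scale `s` of the correction; the other half
  -- makes the map contractive.
  obtain ⟨ε, hε, rfl⟩ : ∃ ε > 0, ε' = ε + ε := ⟨ε' / 2, half_pos hε', by ring⟩
  set s := tPow ε with hs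
  have hdvd₁ : ∀ i, ∃ c, eval a (G i) = s ^ 2 * c := fun i => by
    have := hdvd (Sum.inl i)
    rwa [tPow_add hε.le hε.le, ← sq] at this
  have hdvd₂ : ∀ i j, ∃ e, eval a (MvPolynomial.pderiv j (G i)) - const (D i j) = s * e :=
    fun i j => (tPow_dvd_tPow hε.le (by linarith)).trans (hdvd (Sum.inr (i, j)))
  choose c hc using hdvd₁
  choose e he using hdvd₂
  choose q hq using fun i => MvPolynomial.exists_taylor a s (G i)
  -- With `c`, `e`, `q` as above, the Taylor expansion divided by `s` reads `D h + s * (c + e h +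
  -- q(h)) = 0`; this is solved for `h` by inverting the real matrix `D`.
  obtain ⟨h, hh⟩ := exists_fixedPoint hε fun j =>
    -∑ i, C (const (D⁻¹ j i)) * (C (c i) + ∑ k, C (e i k) * X k + q i)
  simp only [map_neg, map_sum, map_mul, map_add, MvPolynomial.eval_C, MvPolynomial.eval_X] at hh
  have hlin : ∀ i, ∑ j, const (D i j) * h j =
      -(s * (c i + ∑ k, e i k * h k + eval h (q i))) := by
    intro i
    have hDD : ∀ k, ∑ j, const (D i j) * const (D⁻¹ j k) = if i = k then 1 else 0 := by
      intro k
      simp only [← map_mul, ← map_sum]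
      rw [← Matrix.mul_apply, Matrix.mul_nonsing_inv D (isUnit_iff_ne_zero.2 hdet),
        Matrix.one_apply]
      split_ifs <;> simp
    calc ∑ j, const (D i j) * h j
        = ∑ j, ∑ k, -s * ((const (D i j) * const (D⁻¹ j k)) *
            (c k + ∑ l, e k l * h l + eval h (q k))) := by
          refine Finset.sum_congr rfl fun j _ => ?_
          conv_lhs => rw [hh j]
          rw [← Finset.mul_sum]
          simp only [mul_assoc, ← Finset.mul_sum]
          ring
      _ = ∑ k, -s * ((∑ j, const (D i j) * const (D⁻¹ j k)) *
            (c k + ∑ l, e k l * h l + eval h (q k))) := by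
          rw [Finset.sum_comm]
          simp only [← Finset.mul_sum, ← Finset.sum_mul]
      _ = _ := by simp [hDD]
  refine ⟨fun j => a j + s * h j, fun i => ?_, fun j => ?_⟩
  · have hder : ∑ j, eval a (MvPolynomial.pderiv j (G i)) * h j =
        ∑ j, const (D i j) * h j + s * ∑ j, e i j * h j := by
      rw [Finset.mul_sum, ← Finset.sum_add_distrib]
      refine Finset.sum_congr rfl fun j _ => ?_
      rw [sub_eq_iff_eq_add.1 (he i j)]
      ring
    rw [hq, hder, hlin, hc]
    ring
  · simp [ha, residue_const, hs, residue_tPow hε]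

/-! ### Leading terms -/

theorem leading_term_mul {y : realIntegers} (hy : residue y ≠ 0) (a : ℝ) :
    val (term a 1 * y) = -a ∧ coef (term a 1 * y) = (residue y : ℂ) := by
  have h0 : (toHahn y).coeff 0 ≠ 0 := by
    rw [coeff_zero_eq_residue]
    exact_mod_cast hy
  have hc : ∀ r, ((term a 1 * y : Puiseux) : HahnSeries ℝ ℂ).coeff r =
      (toHahn y).coeff (r - a) := fun r => by rw [coeff_term_mul, one_mul]
  have hne : ((term a 1 * y : Puiseux) : HahnSeries ℝ ℂ) ≠ 0 := by
    intro h
    have := hc a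
    rw [h, sub_self] at this
    exact h0 this.symm
  have hord : ((term a 1 * y : Puiseux) : HahnSeries ℝ ℂ).order = a := by
    refine le_antisymm (HahnSeries.order_le_of_coeff_ne_zero (by rwa [hc, sub_self])) ?_
    by_contra hlt
    refine HahnSeries.coeff_order_eq_zero.not.2 hne ?_
    rw [hc, coeff_eq_zero_of_neg y (by linarith)]
  refine ⟨by rw [val, hord], ?_⟩
  rw [coef, HahnSeries.leadingCoeff_eq, hord, hc, sub_self, coeff_zero_eq_residue]

theorem IsReal.ofReal_re_coef {a : Puiseux} (ha : IsReal a) : ((coef a).re : ℂ) = coef a := by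
  rw [coef, HahnSeries.leadingCoeff_eq]
  exact Complex.ext rfl (by simpa using (ha _).symm)

/-! ### Laurent polynomials -/

/-- Evaluation and the operators `z_k ∂_k` are both pairings of coefficients with a weight on
exponents. Linearity of the pairing handles repeated exponents and vanishing coefficients. -/
theorem coeff_sum_single_sum {F ι : Type} [Field F] (S : Finset ι) (g : ι → Fin 2 → ℤ) (c : ι → F)
    (φ : (Fin 2 → ℤ) → F) :
    (∑ i ∈ S, AddMonoidAlgebra.single (g i) (c i) : Laurent F).coeff.sum (fun w a => a * φ w) =
      ∑ i ∈ S, c i * φ (g i) := by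
  rw [AddMonoidAlgebra.coeff_sum, ← Finsupp.sum_finsetSum_index (by simp) (by intros; ring)]
  exact Finset.sum_congr rfl fun i _ => by
    rw [AddMonoidAlgebra.coeff_single, Finsupp.sum_single_index (by simp)]

theorem evalAt_eq_sum {F : Type} [Field F] (f : Laurent F) (z : Fin 2 → F) :
    evalAt f z = f.coeff.sum fun w a => a * ∏ j, z j ^ w j := rfl

/-- The factor `z k` undoes the exponent shift of the derivative, leaving a pairing with the
original exponents. -/
theorem mul_evalAt_partialDeriv {F : Type} [Field F] (f : Laurent F) {z : Fin 2 → F}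
    (hz : ∀ j, z j ≠ 0) (k : Fin 2) :
    z k * evalAt (partialDeriv k f) z =
      f.coeff.sum fun w a => a * ((w k : F) * ∏ j, z j ^ w j) := by
  rw [evalAt_eq_sum, partialDeriv, coeff_sum_single_sum, Finset.mul_sum]
  refine Finset.sum_congr rfl fun w _ => ?_
  have h : z k * ∏ j, z j ^ (w - Pi.single k 1 : Fin 2 → ℤ) j = ∏ j, z j ^ w j := by
    rw [← Finset.mul_prod_erase _ _ (Finset.mem_univ k),
      ← Finset.mul_prod_erase _ (fun j => z j ^ w j) (Finset.mem_univ k), ← mul_assoc]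
    congr 1
    · rw [Pi.sub_apply, Pi.single_eq_same, mul_comm, ← zpow_add_one₀ (hz k), sub_add_cancel]
    · refine Finset.prod_congr rfl fun j hj => ?_
      rw [Pi.sub_apply, Pi.single_eq_of_ne (Finset.ne_of_mem_erase hj), sub_zero]
  simp only [← h]
  ring

/-! ### Cells -/

theorem exists_max (f : Laurent Puiseux) (x : Fin 2 → ℝ) :
    ∃ M, (∀ w ∈ f.coeff.support, tropTerm f w x ≤ M) ∧
      ∀ w ∈ f.coeff.support, w ∈ maxSupport f x ↔ tropTerm f w x = M := by
  rcases f.coeff.support.eq_empty_or_nonempty with h | h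
  · exact ⟨0, by simp [h], by simp [h]⟩
  obtain ⟨v, hv, hmax⟩ := Finset.exists_max_image _ (fun w => tropTerm f w x) h
  exact ⟨tropTerm f v x, hmax, fun w hw => ⟨fun h => le_antisymm (hmax w hw) (h.2 v hv),
    fun h => ⟨hw, fun u hu => (hmax u hu).trans_eq h.symm⟩⟩⟩

/-- From a relative interior point `x`, the segment from `y` to `x` can be prolonged slightly beyond
`x` inside `s`. -/
theorem exists_mem_extension {s : Set (Fin 2 → ℝ)} {x y : Fin 2 → ℝ}
    (hx : x ∈ intrinsicInterior ℝ s) (hy : y ∈ s) :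
    ∃ ε : ℝ, 0 < ε ∧ AffineMap.lineMap x y (-ε) ∈ s := by
  obtain ⟨p, hp, hpx⟩ := mem_intrinsicInterior.1 hx
  have hmem : ∀ ε : ℝ, AffineMap.lineMap x y (-ε) ∈ affineSpan ℝ s := fun ε =>
    AffineMap.lineMap_mem _ (hpx ▸ p.2) (subset_affineSpan ℝ s hy)
  let γ : ℝ → affineSpan ℝ s := fun ε => ⟨_, hmem ε⟩
  have hγ : Continuous γ := by
    refine Continuous.subtype_mk ?_ _
    exact AffineMap.lineMap_continuous.comp continuous_neg
  have hγ0 : γ 0 = p := Subtype.ext (by simp [γ, hpx])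
  have hev : ∀ᶠ ε in nhds (0 : ℝ), γ ε ∈ ((↑) ⁻¹' s : Set (affineSpan ℝ s)) :=
    hγ.continuousAt.eventually (by
      rw [hγ0]
      exact mem_interior_iff_mem_nhds.1 hp)
  obtain ⟨ε, h, hε⟩ := ((hev.filter_mono nhdsWithin_le_nhds).and
    (self_mem_nhdsWithin : Set.Ioi (0 : ℝ) ∈ nhdsWithin 0 (Set.Ioi 0))).exists
  exact ⟨ε, hε, h⟩

theorem tropTerm_lineMap (f : Laurent Puiseux) (w : Fin 2 → ℤ) (x y : Fin 2 → ℝ) (ε : ℝ) :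
    tropTerm f w (AffineMap.lineMap x y (-ε)) =
      (1 + ε) * tropTerm f w x - ε * tropTerm f w y := by
  simp only [tropTerm, AffineMap.lineMap_apply, Fin.sum_univ_two, vsub_eq_sub, vadd_eq_add,
    Pi.add_apply, Pi.smul_apply, Pi.sub_apply, smul_eq_mul]
  ring

theorem cellSupport_eq_maxSupport {f : Laurent Puiseux} {ξ : Set (Fin 2 → ℝ)} (hξ : IsCell f ξ)
    {x : Fin 2 → ℝ} (hx : x ∈ ξ) (hxi : x ∉ intrinsicFrontier ℝ ξ) :
    cellSupport f ξ = maxSupport f x := by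
  refine Set.Subset.antisymm (fun w hw => hw.2 x hx) fun w hw => ⟨hw.1, ?_⟩
  obtain ⟨y, rfl⟩ := hξ
  suffices h : w ∈ maxSupport f y from fun z hz => hz h
  have hint : x ∈ intrinsicInterior ℝ {z | maxSupport f y ⊆ maxSupport f z} := by
    have := subset_intrinsicClosure (𝕜 := ℝ) hx
    rw [← intrinsicInterior_union_intrinsicFrontier] at this
    exact this.resolve_right hxi
  -- The terms of `v` and `w` tie at `x`, and `v` is still maximal beyond `x`. As their difference
  -- is affine, `w` is at least as large as `v` on the opposite side, at `y`.
  obtain ⟨ε, hε, hz⟩ := exists_mem_extension hint (y := y) (Set.Subset.refl _)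
  obtain ⟨v, hv, hmax⟩ := Finset.exists_max_image _ (fun w => tropTerm f w y) ⟨w, hw.1⟩
  have hvy : v ∈ maxSupport f y := ⟨hv, hmax⟩
  have h1 := (hz hvy).2 w hw.1
  have h2 : tropTerm f v x = tropTerm f w x := le_antisymm (hw.2 v hv) ((hx hvy).2 w hw.1)
  rw [tropTerm_lineMap, tropTerm_lineMap, h2] at h1
  have h3 : tropTerm f v y ≤ tropTerm f w y := le_of_mul_le_mul_left (by linarith) hε
  exact ⟨hw.1, fun u hu => (hmax u hu).trans h3⟩

theorem eq_singleton_of_dim_eq_zero {s : Set (Fin 2 → ℝ)} (hs : dim s = 0) {x : Fin 2 → ℝ}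
    (hx : x ∈ s) : s = {x} := by
  have h : vectorSpan ℝ s = ⊥ := Submodule.finrank_eq_zero.1 hs
  exact ((vectorSpan_eq_bot_iff_subsingleton ℝ).1 h).eq_singleton_of_mem hx

/-! ### Rescaling the system -/

/-- Rescaling by `z ↦ t^{-x} z` and dividing by the dominant power of `t` makes each coefficient
integral, with residue the coefficient of the initial form. -/
theorem exists_rescaled_coeff {f : Laurent Puiseux} (hreal : ∀ w, IsReal (f.coeff w))
    {x : Fin 2 → ℝ} {M : ℝ} (hle : ∀ w ∈ f.coeff.support, tropTerm f w x ≤ M)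
    {w : Fin 2 → ℤ} (hw : w ∈ f.coeff.support) :
    ∃ b : realIntegers, (b : Puiseux) = term (M - ∑ j, x j * w j) 1 * f.coeff w ∧
      (tropTerm f w x = M → residue b = (coef (f.coeff w)).re) ∧
      (tropTerm f w x ≠ M → residue b = 0) := by
  have hlt : ∀ r, r < -val (f.coeff w) → (f.coeff w : HahnSeries ℝ ℂ).coeff r = 0 := by
    intro r hr
    rw [val, neg_neg] at hr
    exact HahnSeries.coeff_eq_zero_of_lt_order hr
  have hle' := hle w hw
  refine ⟨⟨term (M - ∑ j, x j * w j) 1 * f.coeff w, ?_, fun r hr => ?_⟩, rfl, fun h => ?_,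
    fun h => ?_⟩
  · exact IsReal.mul (by simpa using isReal_term (M - ∑ j, x j * w j) 1) (hreal w)
  · rw [coeff_term_mul, hlt, mul_zero]
    rw [tropTerm] at hle'
    linarith
  · change ((HahnSeries.coeff _ 0 : ℂ)).re = _
    rw [coeff_term_mul, one_mul, coef, HahnSeries.leadingCoeff_eq]
    congr 2
    rw [tropTerm, val] at h
    linarith
  · change ((HahnSeries.coeff _ 0 : ℂ)).re = _
    rw [coeff_term_mul, hlt, mul_zero, Complex.zero_re]
    have := lt_of_le_of_ne hle' h
    rw [tropTerm] at this
    linarith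

theorem exists_shift {ι : Type*} [Finite ι] {F : Type} [Field F] (f : ι → Laurent F) :
    ∃ N : ℕ, ∀ i, ∀ w ∈ (f i).coeff.support, ∀ j, 0 ≤ w j + N := by
  refine Filter.Eventually.exists (f := Filter.atTop) (Filter.eventually_all.2 fun i =>
    (Finset.eventually_all _).2 fun w _ => Filter.eventually_all.2 fun j => ?_)
  filter_upwards [Filter.eventually_ge_atTop (w j).natAbs] with N hN
  omega

/-- The shifted exponent, as an exponent of an ordinary monomial. -/
def shiftExp (N : ℕ) (w : Fin 2 → ℤ) : Fin 2 →₀ ℕ :=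
  Finsupp.equivFunOnFinite.symm fun j => (w j + N).toNat

theorem cast_shiftExp {N : ℕ} {w : Fin 2 → ℤ} (hw : ∀ j, 0 ≤ w j + N) (j : Fin 2) :
    (shiftExp N w j : ℤ) = w j + N := by
  simp [shiftExp, hw j]

theorem prod_pow_shiftExp {F : Type} [Field F] {N : ℕ} {w : Fin 2 → ℤ} (hw : ∀ j, 0 ≤ w j + N)
    {z : Fin 2 → F} (hz : ∀ j, z j ≠ 0) :
    ∏ j, z j ^ shiftExp N w j = (∏ j, z j) ^ N * ∏ j, z j ^ w j := by
  rw [← Finset.prod_pow, ← Finset.prod_mul_distrib]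
  refine Finset.prod_congr rfl fun j _ => ?_
  rw [← zpow_natCast, cast_shiftExp hw, zpow_add₀ (hz j), zpow_natCast, mul_comm]

theorem eval_monomial_eq_prod {σ R : Type*} [Fintype σ] [CommSemiring R] (y : σ → R) (n : σ →₀ ℕ)
    (b : R) : eval y (MvPolynomial.monomial n b) = b * ∏ j, y j ^ n j := by
  rw [MvPolynomial.eval_monomial, Finsupp.prod_fintype _ _ (by simp)]

/-- The pairing of a reduced polynomial with a weight function, in terms of the rescaled
coefficients. -/
theorem reduced_sum_eq {f : Laurent Puiseux} (hreal : ∀ w, IsReal (f.coeff w))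
    {ξ : Set (Fin 2 → ℝ)} (β : (Fin 2 → ℤ) → ℝ)
    (hβ : ∀ w ∈ f.coeff.support, w ∈ cellSupport f ξ → β w = (coef (f.coeff w)).re)
    (hβ' : ∀ w ∈ f.coeff.support, w ∉ cellSupport f ξ → β w = 0) (φ : (Fin 2 → ℤ) → ℂ) :
    (reduced f ξ).coeff.sum (fun w a => a * φ w) = ∑ w ∈ f.coeff.support, (β w : ℂ) * φ w := by
  classical
  rw [reduced, coeff_sum_single_sum, Finset.sum_filter]
  refine Finset.sum_congr rfl fun w hw => ?_
  split_ifs with h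
  · rw [hβ w hw h, (hreal w).ofReal_re_coef]
  · rw [hβ' w hw h]
    simp

/-- The polynomial with shifted exponents and real coefficients agreeing with the reduced
polynomial has the same zeros and the same Jacobian up to a power of the coordinates. -/
theorem eval_shifted_reduced {N : ℕ} {f : Laurent Puiseux}
    (hN : ∀ w ∈ f.coeff.support, ∀ j, 0 ≤ w j + N)
    {g : Laurent ℂ} (β : (Fin 2 → ℤ) → ℝ)
    (hg : ∀ φ : (Fin 2 → ℤ) → ℂ,
      g.coeff.sum (fun w a => a * φ w) = ∑ w ∈ f.coeff.support, (β w : ℂ) * φ w)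
    {ρ : Fin 2 → ℝ} (hρ : ∀ j, 0 < ρ j) (hzero : evalAt g (fun j => (ρ j : ℂ)) = 0) :
    eval ρ (∑ w ∈ f.coeff.support, MvPolynomial.monomial (shiftExp N w) (β w)) = 0 ∧
    ∀ k, ((eval ρ (MvPolynomial.pderiv k
        (∑ w ∈ f.coeff.support, MvPolynomial.monomial (shiftExp N w) (β w))) : ℝ) : ℂ) =
      (∏ j, (ρ j : ℂ)) ^ N * evalAt (partialDeriv k g) (fun j => (ρ j : ℂ)) := by
  have hρ' : ∀ j, (ρ j : ℂ) ≠ 0 := fun j => by exact_mod_cast (hρ j).ne'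
  rw [evalAt_eq_sum, hg] at hzero
  constructor
  · apply Complex.ofReal_injective
    rw [map_sum, Complex.ofReal_sum, Complex.ofReal_zero,
      ← mul_zero ((∏ j, (ρ j : ℂ)) ^ N), ← hzero, Finset.mul_sum]
    refine Finset.sum_congr rfl fun w hw => ?_
    rw [eval_monomial_eq_prod]
    push_cast
    rw [prod_pow_shiftExp (hN w hw) hρ']
    ring
  · intro k
    -- Compare Euler operators `z_k ∂_k`, which act diagonally on monomials and avoid lowering
    -- exponents.
    refine mul_left_cancel₀ (hρ' k) ?_
    rw [mul_left_comm, mul_evalAt_partialDeriv g hρ', hg]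
    have h1 : ρ k * eval ρ (MvPolynomial.pderiv k
        (∑ w ∈ f.coeff.support, MvPolynomial.monomial (shiftExp N w) (β w))) =
        ∑ w ∈ f.coeff.support, (shiftExp N w k : ℝ) * (β w * ∏ j, ρ j ^ shiftExp N w j) := by
      conv_lhs => rw [← MvPolynomial.eval_X (f := ρ) k]
      rw [← map_mul, map_sum, Finset.mul_sum, map_sum]
      refine Finset.sum_congr rfl fun w _ => ?_
      rw [MvPolynomial.X_mul_pderiv_monomial, map_nsmul, eval_monomial_eq_prod, nsmul_eq_mul]
    -- The product rule for the monomial shift contributes `N` times the value of `g`, which is zero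
    -- at `ρ`.
    have h2 : (∏ j, (ρ j : ℂ)) ^ N * ∑ w ∈ f.coeff.support,
        (β w : ℂ) * ((w k : ℂ) * ∏ j, (ρ j : ℂ) ^ w j) =
        (∏ j, (ρ j : ℂ)) ^ N * (∑ w ∈ f.coeff.support,
          (β w : ℂ) * ((w k : ℂ) * ∏ j, (ρ j : ℂ) ^ w j) +
          N * ∑ w ∈ f.coeff.support, (β w : ℂ) * ∏ j, (ρ j : ℂ) ^ w j) := by
      rw [hzero, mul_zero, add_zero]
    rw [h2, ← Complex.ofReal_mul, h1, Finset.mul_sum, ← Finset.sum_add_distrib, Finset.mul_sum,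
      Complex.ofReal_sum]
    refine Finset.sum_congr rfl fun w hw => ?_
    have h3 : ((shiftExp N w k : ℕ) : ℂ) = w k + N := by
      exact_mod_cast congrArg (Int.cast : ℤ → ℂ) (cast_shiftExp (hN w hw) k)
    push_cast
    rw [h3, prod_pow_shiftExp (hN w hw) hρ']
    ring

/-- A zero of the rescaled and shifted polynomial gives a zero of the Laurent polynomial. -/
theorem evalAt_eq_zero_of_rescaled {N : ℕ} {f : Laurent Puiseux}
    (hN : ∀ w ∈ f.coeff.support, ∀ j, 0 ≤ w j + N) {x : Fin 2 → ℝ} {M : ℝ}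
    {b : (Fin 2 → ℤ) → realIntegers}
    (hb : ∀ w ∈ f.coeff.support,
      (b w : Puiseux) = term (M - ∑ j, x j * w j) 1 * f.coeff w)
    {y : Fin 2 → realIntegers} (hy : ∀ j, (y j : Puiseux) ≠ 0)
    (h : eval y (∑ w ∈ f.coeff.support, MvPolynomial.monomial (shiftExp N w) (b w)) = 0) :
    evalAt f (fun j => term (-x j) 1 * y j) = 0 := by
  -- This is the factor by which the rescaled polynomial at `y` differs from `f` at `t ^ (-x j) * y
  -- j`.
  have hfac : term M 1 * (∏ j, (y j : Puiseux)) ^ N ≠ 0 :=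
    mul_ne_zero (term_one_ne_zero M) (pow_ne_zero _ (Finset.prod_ne_zero_iff.2 fun j _ => hy j))
  refine (mul_eq_zero.1 (Eq.trans ?_ (congrArg (Subtype.val : realIntegers → Puiseux) h))).resolve_left
    hfac
  change _ = realIntegers.subtype _
  rw [map_sum, map_sum, evalAt, Finset.mul_sum]
  refine Finset.sum_congr rfl fun w hw => ?_
  rw [eval_monomial_eq_prod, map_mul, map_prod]
  simp only [map_pow, Subring.subtype_apply]
  rw [prod_pow_shiftExp (hN w hw) hy, hb w hw]
  simp only [mul_zpow, Finset.prod_mul_distrib, term_zpow]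
  have hterm : term (M - ∑ j, x j * w j) 1 = term M 1 * ∏ j, term (w j * -x j) 1 := by
    simp only [Fin.prod_univ_two, Fin.sum_univ_two, term_mul_term, mul_one]
    congr 1
    ring
  rw [hterm]
  ring

/-- The lifting theorem for transversal intersection points of two tropical curves. -/
theorem exists_positive_lift
    (f : Fin 2 → Laurent Puiseux)
    (hreal : ∀ i w, IsReal ((f i).coeff w))
    (ξ : Fin 2 → Set (Fin 2 → ℝ))
    (hξ : IsMixedCell f ξ)
    (hdim : dim (⋂ i, ξ i) = 0)
    (hnondeg : ∀ z : Fin 2 → Puiseux,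
      IsSolution f z → IsNondegenerateSolution f z)
    (ρ : Fin 2 → ℝ) (hρpos : ∀ j, 0 < ρ j)
    (hρ : IsNondegenerateSolution
      (fun i => reduced (f i) (ξ i)) (fun j => (ρ j : ℂ))) :
    ∃ α : Fin 2 → Puiseux,
      IsNondegenerateSolution f α ∧
      (∀ j, IsPositive (α j)) ∧
      (⋂ i, ξ i) = {fun j => val (α j)} ∧
      ∀ j, coef (α j) = (ρ j : ℂ) := by
  obtain ⟨x, hx⟩ := hξ.nonempty
  have hsing := eq_singleton_of_dim_eq_zero hdim hx
  have hcell : ∀ i, cellSupport (f i) (ξ i) = maxSupport (f i) x := fun i =>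
    cellSupport_eq_maxSupport (hξ.isCell i) (Set.mem_iInter.1 hx i) fun h =>
      hξ.not_subset_boundary i (by rw [hsing]; exact Set.singleton_subset_iff.2 h)
  choose M hM hMiff using fun i => exists_max (f i) x
  obtain ⟨N, hN⟩ := exists_shift f
  have hb : ∀ i w, ∃ b : realIntegers, w ∈ (f i).coeff.support →
      (b : Puiseux) = term (M i - ∑ j, x j * w j) 1 * (f i).coeff w ∧
      (tropTerm (f i) w x = M i → residue b = (coef ((f i).coeff w)).re) ∧
      (tropTerm (f i) w x ≠ M i → residue b = 0) := by
    intro i w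
    by_cases hw : w ∈ (f i).coeff.support
    · obtain ⟨b, h⟩ := exists_rescaled_coeff (hreal i) (hM i) hw
      exact ⟨b, fun _ => h⟩
    · exact ⟨0, fun h => absurd h hw⟩
  choose b hb using hb
  have key : ∀ i, _ := fun i => eval_shifted_reduced (hN i) (fun w => residue (b i w))
    (reduced_sum_eq (ξ := ξ i) (hreal i) (fun w => residue (b i w))
      (fun w hw h => (hb i w hw).2.1 ((hMiff i w hw).1 (hcell i ▸ h)))
      (fun w hw h => (hb i w hw).2.2 fun h' => h (hcell i ▸ (hMiff i w hw).2 h')))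
    hρpos (hρ.1.2 i)
  obtain ⟨y, hy0, hyρ⟩ := exists_hensel_lift
    (fun i => ∑ w ∈ (f i).coeff.support, MvPolynomial.monomial (shiftExp N w) (b i w)) ρ
    (fun i => by simpa only [map_sum, MvPolynomial.map_monomial] using (key i).1)
    (by
      simp only [map_sum (MvPolynomial.map residue), MvPolynomial.map_monomial]
      intro h0
      refine hρ.2 ?_
      -- Each of the two Jacobian rows carries a factor `(∏ j, ρ j) ^ N`, so the determinant carries
      -- its square.
      have hρN : ((∏ j, (ρ j : ℂ)) ^ N) ^ 2 ≠ 0 := pow_ne_zero _ (pow_ne_zero _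
        (Finset.prod_ne_zero_iff.2 fun j _ => hρ.1.1 j))
      refine (mul_eq_zero.1 (Eq.trans ?_ (congrArg Complex.ofReal h0))).resolve_left hρN
      rw [Matrix.det_fin_two, Matrix.det_fin_two]
      simp only [Matrix.of_apply, jacobian, Complex.ofReal_sub, Complex.ofReal_mul,
        fun i => (key i).2]
      ring)
  have hres : ∀ j, residue (y j) ≠ 0 := fun j => by
    rw [hyρ]
    exact (hρpos j).ne'
  have hyne : ∀ j, (y j : Puiseux) ≠ 0 := fun j h => hres j (by
    rw [show y j = 0 from Subtype.ext h, map_zero])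
  refine ⟨fun j => term (-x j) 1 * y j, hnondeg _ ⟨fun j =>
    mul_ne_zero (term_one_ne_zero _) (hyne j), fun i =>
      evalAt_eq_zero_of_rescaled (hN i) (fun w hw => (hb i w hw).1) hyne (hy0 i)⟩,
    fun j => ⟨IsReal.mul (by simpa using isReal_term (-x j) 1) (y j).2.1, ?_⟩, ?_, fun j => ?_⟩
  · rw [(leading_term_mul (hres j) _).2, hyρ]
    exact hρpos j
  · rw [hsing]
    congr 1
    funext j
    rw [(leading_term_mul (hres j) _).1, neg_neg]
  · rw [(leading_term_mul (hres j) _).2, hyρ]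

end PuiseuxTropical

end

theorem proposition4p4
    (f : Fin 2 → PuiseuxTropical.Laurent PuiseuxTropical.Puiseux)
    (hreal : ∀ i w, PuiseuxTropical.IsReal ((f i).coeff w))
    (ξ : Fin 2 → Set (Fin 2 → ℝ))
    (hξ : PuiseuxTropical.IsMixedCell f ξ)
    (hdim : PuiseuxTropical.dim (⋂ i, ξ i) = 0)
    (hnondeg : ∀ z : Fin 2 → PuiseuxTropical.Puiseux,
      PuiseuxTropical.IsSolution f z → PuiseuxTropical.IsNondegenerateSolution f z)
    (ρ : Fin 2 → ℝ) (hρpos : ∀ j, 0 < ρ j)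
    (hρ : PuiseuxTropical.IsNondegenerateSolution
      (fun i => PuiseuxTropical.reduced (f i) (ξ i)) (fun j => (ρ j : ℂ))) :
    ∃ α : Fin 2 → PuiseuxTropical.Puiseux,
      PuiseuxTropical.IsNondegenerateSolution f α ∧
      (∀ j, PuiseuxTropical.IsPositive (α j)) ∧
      (⋂ i, ξ i) = {fun j => PuiseuxTropical.val (α j)} ∧
      ∀ j, PuiseuxTropical.coef (α j) = (ρ j : ℂ) :=
  PuiseuxTropical.exists_positive_lift f hreal ξ hξ hdim hnondeg ρ hρpos hρ
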